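/- Let $I\subset\mathbf R$ be an open bounded interval, let $f\colon I\to\mathbf R$ be a $C^\infty$-function, and let $x$ and $h$ be self-adjoint operators on a complex Hilbert space of finite dimension $n$, written in the form \[ x=\sum_{i=1}^n\lambda_i e_{ii},\qquad h=\sum_{i,j=1}^n h_{ij}e_{ij}, \] where $\{e_{ij}\}_{i,j=1}^n$ is a system of matrix units (that is, $e_{ij}e_{kl}=\delta_{jk}e_{il}$, $e_{ij}^*=e_{ji}$ and $\sum_i e_{ii}=1$), $h_{ij}\in\mathbf C$, and $\lambda_1,\dots,\lambda_n\in\mathbf R$ are the eigenvalues of $x$ counted with multiplicity. Assume that the spectrum of $x$ is contained in $I$. For a self-adjoint operator $y=\sum_k\mu_kP_k$ (spectral resolution) with spectrum in $I$ put $f(y)=\sum_k f(\mu_k)P_k$. Then there is $\varepsilon>0$ such that for $|t|<\varepsilon$ the spectrum of $x+th$ is contained in $I$, and the trace function $t\mapsto\operatorname{tr}f(x+th)$ is infinitely differentiable on $(-\varepsilon,\varepsilon)$. Moreover, for every $p=1,2,\dots$, \[ \frac{d^p}{dt^p}\operatorname{tr}f(x+th)\Big|_{t=0} =p!\sum_{i_1=1}^n\cdots\sum_{i_p=1}^n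 h_{i_1i_2}h_{i_2i_3}\cdots h_{i_{p-1}i_p}h_{i_pi_1}\, [\lambda_{i_1},\lambda_{i_2},\dots,\lambda_{i_p},\lambda_{i_1}]_f . \] Here $[x_0,\dots,x_m]_f$ denotes the divided difference of $f$ at the not necessarily distinct points $x_0,\dots,x_m\in I$: it is the symmetric function of the points determined by $[x_0]_f=f(x_0)$, by \[ [x_0,\dots,x_m]_f=\frac{[x_0,\dots,x_{m-1}]_f-[x_1,\dots,x_m]_f}{x_0-x_m}\qquad\text{if } x_0\neq x_m, \] and by $[x_0,\dots,x_0]_f=f^{(m)}(x_0)/m!$ when all $m+1$ points coincide. -/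

import Mathlib

open scoped ContDiff

/-- The divided difference `[x₀, …, xₙ]_f` at a list of nodes in which equal nodes are adjacent
(in particular at a monotone list).  If `x₀ ≠ xₙ` it is
`([x₀, …, xₙ₋₁]_f - [x₁, …, xₙ]_f) / (x₀ - xₙ)`, and for coinciding nodes it is `f⁽ⁿ⁾(x₀) / n!`. -/
noncomputable def dividedDiffSorted (f : ℝ → ℝ) : (n : ℕ) → (Fin (n + 1) → ℝ) → ℝ
  | 0, x => f (x 0)
  | n + 1, x =>
    if x 0 = x (Fin.last (n + 1)) then
      iteratedDeriv (n + 1) f (x 0) / ((n + 1).factorial : ℝ)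
    else
      (dividedDiffSorted f n (Fin.init x) - dividedDiffSorted f n (Fin.tail x)) /
        (x 0 - x (Fin.last (n + 1)))

/-- The divided difference `[x₀, …, xₙ]_f` at arbitrary, not necessarily distinct, nodes.
It is a symmetric function of the nodes, which are first put in increasing order. -/
noncomputable def dividedDiff (f : ℝ → ℝ) {n : ℕ} (x : Fin (n + 1) → ℝ) : ℝ :=
  dividedDiffSorted f n (x ∘ Tuple.sort x)

/-- A (self-adjoint, unital) system of `n × n` matrix units in a unital `*`-ring. -/
structure IsMatrixUnits {A : Type*} [Ring A] [StarRing A] {n : ℕ} (e : Fin n → Fin n → A) :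
    Prop where
  mul_eq : ∀ i j k l, e i j * e k l = if j = k then e i l else 0
  star_eq : ∀ i j, star (e i j) = e j i
  sum_eq_one : ∑ i, e i i = 1

/-- The function `t ↦ tr f(x + t h)` for operators `x`, `h` on a finite dimensional complex
Hilbert space; `f(x + t h)` is given by the functional calculus, which on a self-adjoint operator
with spectral resolution `∑ μᵢ Pᵢ` is `∑ f(μᵢ) Pᵢ`. -/
noncomputable def traceFun {H : Type*} [NormedAddCommGroup H] [InnerProductSpace ℂ H]
    [CompleteSpace H] (f : ℝ → ℝ) (x h : H →L[ℂ] H) (t : ℝ) : ℂ :=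
  LinearMap.trace ℂ H ((cfc f (x + (t : ℂ) • h) : H →L[ℂ] H) : H →ₗ[ℂ] H)

/-! In a basis where `x` is diagonal, `q(x + t h)` for a polynomial `q` has entries polynomial in
`t`. The coefficient of `t ^ p` is a sum over paths of length `p`: the product of the entries of `h`
along the path, times the divided difference of `q` at the eigenvalues visited
(`pencilCoeff_eq_sum`). The trace keeps the closed paths, which is the formula for polynomials.
Defining `polyDD` by a remainder makes it visibly symmetric in the nodes, and dividing by `X - λ`
removes one node, which drives all the recursions.

A smooth `f` is reached by approximation. Polynomials `q m` converge to `f` with all derivatives,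
uniformly on a compact interval containing the spectra of `x + t h` for small `t`. Re-diagonalising
at each such `t` makes the polynomial formula available there, and a divided difference of order `p`
is bounded by the supremum of the `p`-th derivative (`abs_polyDD_le`). Hence the `t`-derivatives of
the polynomial traces are uniformly Cauchy; this gives smoothness of the limit and convergence of
both sides of the formula at `0`. -/

open Polynomial in
/-- The divided difference of a polynomial, as the top coefficient of its remainder modulo the
nodal polynomial. -/
noncomputable def polyDD (q : ℝ[X]) {n : ℕ} (x : Fin (n + 1) → ℝ) : ℝ :=
  (q %ₘ ∏ i, (X - C (x i))).coeff n

/-! ### Divided differences of polynomials -/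

section PolyDD

open Polynomial

theorem monic_nodal {n : ℕ} (x : Fin n → ℝ) : (∏ i, (X - C (x i)) : ℝ[X]).Monic :=
  monic_prod_of_monic _ _ fun i _ => monic_X_sub_C (x i)

theorem degree_nodal {n : ℕ} (x : Fin n → ℝ) : (∏ i, (X - C (x i)) : ℝ[X]).degree = n := by
  simp [degree_prod]

/-- Dividing by `X - a` and then the quotient by `W` leaves `(X - a) r + q(a)`, with `r` the second
remainder; the top coefficient is that of `r`. -/
theorem coeff_modByMonic_X_sub_C_mul {n : ℕ} {W : ℝ[X]} (hW : W.Monic)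
    (hd : W.degree = (n + 1 : ℕ)) (a : ℝ) (q : ℝ[X]) :
    (q %ₘ ((X - C a) * W)).coeff (n + 1) = ((q /ₘ (X - C a)) %ₘ W).coeff n := by
  have hR : ((q /ₘ (X - C a)) %ₘ W).degree < (n + 1 : ℕ) := hd ▸ degree_modByMonic_lt _ hW
  have key : q %ₘ ((X - C a) * W) = (X - C a) * ((q /ₘ (X - C a)) %ₘ W) + C (q.eval a) := by
    refine (div_modByMonic_unique ((q /ₘ (X - C a)) /ₘ W) _ ((monic_X_sub_C a).mul hW)
      ⟨?_, ?_⟩).2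
    · have h1 := modByMonic_add_div q (X - C a)
      have h2 := modByMonic_add_div (q /ₘ (X - C a)) W
      rw [modByMonic_X_sub_C_eq_C_eval] at h1
      linear_combination h1 + (X - C a) * h2
    · rw [degree_mul, hd, degree_X_sub_C]
      refine (degree_add_le _ _).trans_lt (max_lt ?_ ?_)
      · rw [degree_mul, degree_X_sub_C]
        exact WithBot.add_lt_add_left (by simp) hR
      · refine degree_C_le.trans_lt ?_
        norm_cast
        omega
  have h0 : ((q /ₘ (X - C a)) %ₘ W).coeff (n + 1) = 0 := coeff_eq_zero_of_degree_lt hR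
  rw [key, sub_mul]
  simp [coeff_X_mul, h0]

theorem X_mul_divByMonic_X_sub_C (a : ℝ) (q : ℝ[X]) :
    (X * q) /ₘ (X - C a) = q + C a * (q /ₘ (X - C a)) := by
  have h1 := modByMonic_add_div q (X - C a)
  rw [modByMonic_X_sub_C_eq_C_eval] at h1
  refine (div_modByMonic_unique _ (C a * C (q.eval a)) (monic_X_sub_C a) ⟨?_, ?_⟩).1
  · linear_combination C a * h1
  · rw [degree_X_sub_C, ← C_mul]
    exact degree_C_le.trans_lt (by norm_num)

theorem add_divByMonic' (p q g : ℝ[X]) (hg : g.Monic) :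
    (p + q) /ₘ g = p /ₘ g + q /ₘ g := by
  refine (div_modByMonic_unique _ (p %ₘ g + q %ₘ g) hg ⟨?_, ?_⟩).1
  · linear_combination modByMonic_add_div p g + modByMonic_add_div q g
  · exact (degree_add_le _ _).trans_lt
      (max_lt (degree_modByMonic_lt _ hg) (degree_modByMonic_lt _ hg))

theorem C_mul_modByMonic (c : ℝ) (q W : ℝ[X]) : (C c * q) %ₘ W = C c * (q %ₘ W) := by
  rw [← smul_eq_C_mul, ← smul_eq_C_mul, smul_modByMonic]

theorem C_mul_divByMonic (c : ℝ) (q : ℝ[X]) {g : ℝ[X]} (hg : g.Monic) :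
    (C c * q) /ₘ g = C c * (q /ₘ g) := by
  refine (div_modByMonic_unique _ (C c * (q %ₘ g)) hg ⟨?_, ?_⟩).1
  · linear_combination C c * modByMonic_add_div q g
  · rw [← C_mul_modByMonic]
    exact degree_modByMonic_lt _ hg

theorem polyDD_zero (q : ℝ[X]) (x : Fin 1 → ℝ) : polyDD q x = q.eval (x 0) := by
  simp [polyDD, modByMonic_X_sub_C_eq_C_eval]

theorem polyDD_succ (q : ℝ[X]) {n : ℕ} (x : Fin (n + 2) → ℝ) :
    polyDD q x = polyDD (q /ₘ (X - C (x 0))) (Fin.tail x) := by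
  rw [polyDD, Fin.prod_univ_succ, coeff_modByMonic_X_sub_C_mul (monic_nodal _) (degree_nodal _)]
  rfl

theorem polyDD_comp_perm (q : ℝ[X]) {n : ℕ} (x : Fin (n + 1) → ℝ) (s : Equiv.Perm (Fin (n + 1))) :
    polyDD q (x ∘ s) = polyDD q x := by
  unfold polyDD
  rw [← Equiv.prod_comp s fun i => X - C (x i)]
  rfl

theorem coeff_X_mul_modByMonic {n : ℕ} {W : ℝ[X]} (hW : W.Monic)
    (hd : W.degree = (n + 1 : ℕ)) (a : ℝ) (q : ℝ[X]) :
    ((X * q) %ₘ ((X - C a) * W)).coeff (n + 1) =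
      (q %ₘ W).coeff n + a * (q %ₘ ((X - C a) * W)).coeff (n + 1) := by
  rw [coeff_modByMonic_X_sub_C_mul hW hd, coeff_modByMonic_X_sub_C_mul hW hd,
    X_mul_divByMonic_X_sub_C, add_modByMonic, C_mul_modByMonic]
  simp

theorem polyDD_X_mul_tail (q : ℝ[X]) {n : ℕ} (x : Fin (n + 2) → ℝ) :
    polyDD (X * q) x = polyDD q (Fin.tail x) + x 0 * polyDD q x := by
  simp only [polyDD]
  rw [Fin.prod_univ_succ, coeff_X_mul_modByMonic (monic_nodal _) (degree_nodal _)]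
  rfl

theorem polyDD_X_mul_init (q : ℝ[X]) {n : ℕ} (x : Fin (n + 2) → ℝ) :
    polyDD (X * q) x = polyDD q (Fin.init x) + x (Fin.last _) * polyDD q x := by
  simp only [polyDD]
  rw [Fin.prod_univ_castSucc, mul_comm _ (X - C (x (Fin.last (n + 1)))),
    coeff_X_mul_modByMonic (monic_nodal _) (degree_nodal _)]
  rfl

/-- Peeling off the first or the last node computes the divided difference of `X * q` in two ways.
-/
theorem polyDD_sub (q : ℝ[X]) {n : ℕ} (x : Fin (n + 2) → ℝ) :
    polyDD q (Fin.init x) - polyDD q (Fin.tail x) = (x 0 - x (Fin.last _)) * polyDD q x := by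
  linear_combination polyDD_X_mul_tail q x - polyDD_X_mul_init q x

theorem iterate_derivative_X_sub_C_mul (a : ℝ) (r : ℝ[X]) (k : ℕ) :
    derivative^[k + 1] ((X - C a) * r) =
      (X - C a) * derivative^[k + 1] r + (k + 1 : ℝ[X]) * derivative^[k] r := by
  induction k with
  | zero => simp [add_comm]
  | succ k ih =>
    rw [Function.iterate_succ_apply', ih, derivative_add, derivative_mul,
      ← Function.iterate_succ_apply' derivative, derivative_mul,
      ← Function.iterate_succ_apply' derivative]
    simp
    ring

theorem iterate_derivative_divByMonic (a : ℝ) (q : ℝ[X]) (k : ℕ) :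
    derivative^[k + 1] q = (X - C a) * derivative^[k + 1] (q /ₘ (X - C a)) +
      (k + 1 : ℝ[X]) * derivative^[k] (q /ₘ (X - C a)) := by
  rw [← iterate_derivative_X_sub_C_mul]
  nth_rw 1 [← modByMonic_add_div q (X - C a)]
  rw [modByMonic_X_sub_C_eq_C_eval, iterate_map_add, iterate_derivative_C (by omega),
    zero_add]

theorem polyDD_const (q : ℝ[X]) (n : ℕ) (a : ℝ) :
    polyDD q (fun _ : Fin (n + 1) => a) = (derivative^[n] q).eval a / n.factorial := by
  induction n generalizing q with
  | zero => simp [polyDD_zero]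
  | succ n ih =>
    rw [polyDD_succ, show Fin.tail (fun _ : Fin (n + 2) => a) = fun _ => a from rfl, ih,
      iterate_derivative_divByMonic a q n, Nat.factorial_succ]
    have : (n.factorial : ℝ) ≠ 0 := by positivity
    simp
    field_simp

theorem iteratedDeriv_polynomial_eval (q : ℝ[X]) (k : ℕ) :
    iteratedDeriv k (fun t => q.eval t) = fun t => (derivative^[k] q).eval t := by
  induction k with
  | zero => simp
  | succ k ih =>
    rw [iteratedDeriv_succ, ih, Function.iterate_succ_apply']
    ext t
    simp

theorem dividedDiffSorted_polynomial (q : ℝ[X]) (n : ℕ) (x : Fin (n + 1) → ℝ) (hx : Monotone x) :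
    dividedDiffSorted (fun t => q.eval t) n x = polyDD q x := by
  induction n with
  | zero => rw [dividedDiffSorted, polyDD_zero]
  | succ n ih =>
    rw [dividedDiffSorted]
    split_ifs with h
    · have hc : x = fun _ => x 0 := by
        ext i
        exact le_antisymm (h ▸ hx (Fin.le_last i)) (hx (Fin.zero_le i))
      rw [iteratedDeriv_polynomial_eval, hc, polyDD_const]
    · rw [ih (Fin.init x) (fun i j hij => hx (Fin.castSucc_le_castSucc_iff.2 hij)),
        ih (Fin.tail x) (fun i j hij => hx (Fin.succ_le_succ_iff.2 hij)), polyDD_sub,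
        mul_div_cancel_left₀ _ (sub_ne_zero.2 h)]

theorem dividedDiff_polynomial (q : ℝ[X]) {n : ℕ} (x : Fin (n + 1) → ℝ) :
    dividedDiff (fun t => q.eval t) x = polyDD q x := by
  rw [dividedDiff, dividedDiffSorted_polynomial _ _ _ (Tuple.monotone_sort x), polyDD_comp_perm]

/-- Removing a node costs one derivative and does not enlarge the bound, so it can be iterated. The
sharper factor `1 / (k + 1)` is dropped. -/
theorem abs_iterate_derivative_divByMonic_le {c d a B : ℝ} (ha : a ∈ Set.Icc c d) (q : ℝ[X])
    (k : ℕ) (hB : ∀ y ∈ Set.Icc c d, |(derivative^[k + 1] q).eval y| ≤ B) :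
    ∀ y ∈ Set.Icc c d, |(derivative^[k] (q /ₘ (X - C a))).eval y| ≤ B := by
  intro y hy
  set u := derivative^[k] (q /ₘ (X - C a)) with hu
  have hid : ∀ z, (derivative^[k + 1] q).eval z =
      (z - a) * (derivative u).eval z + (k + 1) * u.eval z := by
    intro z
    rw [iterate_derivative_divByMonic a q k, Function.iterate_succ_apply', ← hu]
    simp
  have hB0 : 0 ≤ B := (abs_nonneg _).trans (hB y hy)
  rcases eq_or_ne y a with rfl | hne
  · have h1 := hB y hy
    rw [hid, sub_self, zero_mul, zero_add, abs_mul, abs_of_nonneg (by positivity)] at h1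
    nlinarith [abs_nonneg (u.eval y), (Nat.cast_nonneg k : (0 : ℝ) ≤ k)]
  -- By `hid`, `(z - a) ^ k` is an integrating factor; the mean value inequality from `a`, where the
  -- product vanishes, then bounds `u y`.
  · have hder : ∀ z, HasDerivAt (fun z => (z - a) ^ (k + 1) * u.eval z)
        ((z - a) ^ k * (derivative^[k + 1] q).eval z) z := by
      intro z
      have h := (((hasDerivAt_id z).sub_const a).pow (k + 1)).mul (u.hasDerivAt z)
      refine h.congr_deriv ?_
      rw [hid]
      simp
      ring
    have hsub : Set.uIcc a y ⊆ Set.Icc c d := Set.uIcc_subset_Icc ha hy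
    have hm := (convex_uIcc a y).norm_image_sub_le_of_norm_hasDerivWithin_le
      (f := fun z => (z - a) ^ (k + 1) * u.eval z) (C := |y - a| ^ k * B)
      (fun z _ => (hder z).hasDerivWithinAt) (fun z hz => by
        rw [norm_mul, norm_pow, Real.norm_eq_abs, Real.norm_eq_abs]
        have h1 : |z - a| ≤ |y - a| := Set.abs_sub_left_of_mem_uIcc hz
        gcongr
        exact hB z (hsub hz)) Set.left_mem_uIcc Set.right_mem_uIcc
    simp only [sub_self, ne_eq, Nat.add_eq_zero_iff, one_ne_zero, and_false, not_false_eq_true,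
      zero_pow, zero_mul, sub_zero, norm_mul, norm_pow, Real.norm_eq_abs] at hm
    have hp : 0 < |y - a| ^ (k + 1) := pow_pos (abs_pos.2 (sub_ne_zero.2 hne)) _
    refine le_of_mul_le_mul_left (hm.trans (le_of_eq ?_)) hp
    ring

theorem abs_polyDD_le {c d B : ℝ} (q : ℝ[X]) (n : ℕ) (x : Fin (n + 1) → ℝ)
    (hx : ∀ i, x i ∈ Set.Icc c d)
    (hB : ∀ y ∈ Set.Icc c d, |(derivative^[n] q).eval y| ≤ B) : |polyDD q x| ≤ B := by
  induction n generalizing q with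
  | zero =>
    rw [polyDD_zero]
    exact hB _ (hx 0)
  | succ n ih =>
    rw [polyDD_succ]
    exact ih _ _ (fun i => hx i.succ)
      (abs_iterate_derivative_divByMonic_le (hx 0) q n hB)

end PolyDD

/-! ### Path expansion of a polynomial in `D + X M` -/

section Pencil

open Polynomial Matrix

variable {n : ℕ}

/-- The pencil `D + X M`, with `D` the diagonal matrix of the `lam i`. -/
noncomputable def matrixPencil (M : Matrix (Fin n) (Fin n) ℂ) (lam : Fin n → ℝ) :
    Matrix (Fin n) (Fin n) ℂ[X] :=
  diagonal (fun i => C (lam i : ℂ)) + (X : ℂ[X]) • M.map C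

/-- The coefficients of the entries of `q(D + X M)`. -/
noncomputable def pencilCoeff (M : Matrix (Fin n) (Fin n) ℂ) (lam : Fin n → ℝ) :
    ℕ → ℝ[X] → Fin n → Fin n → ℂ
  | 0, q, i, j => if i = j then ((q.eval (lam i) : ℝ) : ℂ) else 0
  | p + 1, q, i, j => ∑ k, M i k * pencilCoeff M lam p (q /ₘ (X - C (lam i))) k j

theorem pencilCoeff_add (M : Matrix (Fin n) (Fin n) ℂ) (lam : Fin n → ℝ) (p : ℕ) (q r : ℝ[X])
    (i j : Fin n) :
    pencilCoeff M lam p (q + r) i j = pencilCoeff M lam p q i j + pencilCoeff M lam p r i j := by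
  induction p generalizing q r i with
  | zero =>
    simp only [pencilCoeff]
    split_ifs <;> simp
  | succ p ih =>
    simp only [pencilCoeff]
    simp_rw [add_divByMonic' _ _ _ (monic_X_sub_C _), ih, mul_add, Finset.sum_add_distrib]

theorem pencilCoeff_C_mul (M : Matrix (Fin n) (Fin n) ℂ) (lam : Fin n → ℝ) (p : ℕ) (a : ℝ)
    (q : ℝ[X]) (i j : Fin n) :
    pencilCoeff M lam p (C a * q) i j = a * pencilCoeff M lam p q i j := by
  induction p generalizing q i with
  | zero =>
    simp only [pencilCoeff]
    split_ifs <;> simp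
  | succ p ih =>
    simp only [pencilCoeff]
    simp_rw [C_mul_divByMonic _ _ (monic_X_sub_C _), ih, Finset.mul_sum]
    exact Finset.sum_congr rfl fun k _ => by ring

theorem pencilCoeff_succ_C (M : Matrix (Fin n) (Fin n) ℂ) (lam : Fin n → ℝ) (p : ℕ) (a : ℝ)
    (i j : Fin n) : pencilCoeff M lam (p + 1) (C a) i j = 0 := by
  have h0 : ∀ k, pencilCoeff M lam p 0 k j = 0 := fun k => by
    simpa using pencilCoeff_C_mul M lam p 0 0 k j
  simp only [pencilCoeff]
  refine Finset.sum_eq_zero fun k _ => ?_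
  rw [(divByMonic_eq_zero_iff (monic_X_sub_C _)).2, h0, mul_zero]
  rw [degree_X_sub_C]
  exact degree_C_le.trans_lt (by norm_num)

theorem pencilCoeff_succ_X_mul (M : Matrix (Fin n) (Fin n) ℂ) (lam : Fin n → ℝ) (p : ℕ)
    (q : ℝ[X]) (i j : Fin n) :
    pencilCoeff M lam (p + 1) (X * q) i j =
      lam i * pencilCoeff M lam (p + 1) q i j + ∑ k, M i k * pencilCoeff M lam p q k j := by
  simp only [pencilCoeff]
  simp_rw [X_mul_divByMonic_X_sub_C, pencilCoeff_add, pencilCoeff_C_mul, mul_add,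
    Finset.sum_add_distrib, Finset.mul_sum]
  rw [add_comm]
  congr 1
  exact Finset.sum_congr rfl fun k _ => by ring

/-- Multiplication by `D + X M` acts on coefficients by the recursion of `pencilCoeff_succ_X_mul`,
so induction on monomials suffices. -/
theorem coeff_aeval_matrixPencil (M : Matrix (Fin n) (Fin n) ℂ) (lam : Fin n → ℝ) (q : ℝ[X])
    (p : ℕ) (i j : Fin n) :
    (aeval (matrixPencil M lam) q i j).coeff p = pencilCoeff M lam p q i j := by
  induction q using Polynomial.induction_on generalizing p i j with
  | C a =>
    rw [aeval_C, Matrix.algebraMap_matrix_apply]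
    cases p with
    | zero =>
      simp only [pencilCoeff]
      split_ifs <;> simp [Polynomial.algebraMap_apply]
    | succ p =>
      rw [pencilCoeff_succ_C]
      split_ifs <;> simp [Polynomial.algebraMap_apply]
  | add q r hq hr => rw [map_add, Matrix.add_apply, coeff_add, hq, hr, pencilCoeff_add]
  | monomial m a ih =>
    rw [pow_succ', mul_left_comm]
    set r : ℝ[X] := C a * X ^ m
    rw [map_mul, aeval_X]
    nth_rw 1 [matrixPencil]
    rw [add_mul, Matrix.add_apply, diagonal_mul, smul_mul, Matrix.smul_apply, smul_eq_mul,
      coeff_add, coeff_C_mul, ih]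
    cases p with
    | zero =>
      simp only [pencilCoeff, coeff_X_mul_zero, add_zero]
      split_ifs <;> simp
    | succ p =>
      rw [coeff_X_mul, Matrix.mul_apply, finsetSum_coeff, pencilCoeff_succ_X_mul]
      simp [ih]

/-- The contribution of the path `w` to the coefficients of `q(D + X M)`. -/
noncomputable def pathWeight (M : Matrix (Fin n) (Fin n) ℂ) (lam : Fin n → ℝ) {p : ℕ} (q : ℝ[X])
    (w : Fin (p + 1) → Fin n) : ℂ :=
  (∏ k : Fin p, M (w k.castSucc) (w k.succ)) * (polyDD q fun k => lam (w k) : ℝ)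

theorem pathWeight_cons (M : Matrix (Fin n) (Fin n) ℂ) (lam : Fin n → ℝ) {p : ℕ} (q : ℝ[X])
    (i : Fin n) (w : Fin (p + 1) → Fin n) :
    pathWeight M lam q (Fin.cons i w : Fin (p + 2) → Fin n) =
      M i (w 0) * pathWeight M lam (q /ₘ (X - C (lam i))) w := by
  rw [pathWeight, polyDD_succ, Fin.prod_univ_succ, pathWeight, ← mul_assoc]
  rfl

/-- Each unrolling of the recursion chooses the next vertex of the path and divides by `X - λ`,
which is how `polyDD` sheds its first node. -/
theorem pencilCoeff_eq_sum (M : Matrix (Fin n) (Fin n) ℂ) (lam : Fin n → ℝ) (p : ℕ) (q : ℝ[X])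
    (i j : Fin n) :
    pencilCoeff M lam p q i j =
      ∑ w : Fin (p + 1) → Fin n, if w 0 = i ∧ w (Fin.last p) = j then pathWeight M lam q w
        else 0 := by
  induction p generalizing q i with
  | zero =>
    rw [← (Equiv.funUnique (Fin 1) (Fin n)).symm.sum_comp]
    simp only [pencilCoeff, pathWeight, polyDD_zero]
    simp [ite_and]
  | succ p ih =>
    rw [← (Fin.consEquiv fun _ => Fin n).sum_comp, Fintype.sum_prod_type]
    simp only [Fin.consEquiv, Equiv.coe_fn_mk, Fin.cons_zero, pathWeight_cons, ite_and,
      ← Fin.succ_last, Fin.cons_succ, pencilCoeff, ih, Finset.mul_sum]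
    rw [Finset.sum_comm, Finset.sum_comm (s := Finset.univ) (t := Finset.univ)
      (f := fun (a : Fin n) (w : Fin (p + 1) → Fin n) => ite (a = i) _ _)]
    simp

theorem coeff_trace_aeval_matrixPencil (M : Matrix (Fin n) (Fin n) ℂ) (lam : Fin n → ℝ)
    (q : ℝ[X]) (p : ℕ) (hp : 0 < p) :
    (trace (aeval (matrixPencil M lam) q)).coeff p =
      ∑ i : Fin p → Fin n, (∏ k, M (i k) (i (finRotate p k))) *
        (polyDD q (Fin.snoc (α := fun _ => ℝ) (fun k : Fin p => lam (i k)) (lam (i ⟨0, hp⟩))) :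
          ℝ) := by
  obtain ⟨p, rfl⟩ := Nat.exists_eq_succ_of_ne_zero hp.ne'
  simp only [trace, diag_apply, finsetSum_coeff, coeff_aeval_matrixPencil, pencilCoeff_eq_sum]
  rw [Finset.sum_comm]
  simp only [ite_and, Finset.sum_ite_eq, Finset.mem_univ, if_true]
  -- Split off the final vertex: closedness forces it to equal the first, so its sum collapses and
  -- `finRotate` supplies the closing edge.
  rw [← (Fin.snocEquiv fun _ => Fin n).sum_comp, Fintype.sum_prod_type, Finset.sum_comm]
  refine Finset.sum_congr rfl fun u _ => ?_
  simp only [Fin.snocEquiv, Equiv.coe_fn_mk, Fin.snoc_last]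
  have h0 : ∀ a : Fin n, (Fin.snoc (α := fun _ => Fin n) u a : Fin (p + 2) → Fin n) 0 = u 0 :=
    fun a => Fin.snoc_castSucc (α := fun _ => Fin n) a u 0
  simp only [h0, Finset.sum_ite_eq', Finset.mem_univ, if_true]
  rw [pathWeight]
  congr 1
  · refine Finset.prod_congr rfl fun k _ => ?_
    rw [Fin.snoc_castSucc (α := fun _ => Fin n)]
    congr 1
    refine Fin.lastCases ?_ (fun k => ?_) k
    · rw [Fin.succ_last, Fin.snoc_last, finRotate_last]
    · rw [Fin.succ_castSucc, Fin.snoc_castSucc (α := fun _ => Fin n), finRotate_apply]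
      simp
  · congr 2
    ext k
    refine Fin.lastCases ?_ (fun k => ?_) k
    · simp
    · simp

end Pencil

/-! ### From matrices to operators on `H` -/

section Operators

open Polynomial Matrix

variable {H : Type*} [NormedAddCommGroup H] [InnerProductSpace ℂ H] {n : ℕ}

theorem iteratedDeriv_eval_ofReal (P : ℂ[X]) (k : ℕ) :
    iteratedDeriv k (fun t : ℝ => P.eval (t : ℂ)) = fun t : ℝ => (derivative^[k] P).eval (t : ℂ) := by
  induction k with
  | zero => simp
  | succ k ih =>
    rw [iteratedDeriv_succ, ih, Function.iterate_succ_apply']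
    ext t
    exact ((derivative^[k] P).hasDerivAt (t : ℂ)).comp_ofReal.deriv

theorem iteratedDeriv_eval_ofReal_zero (P : ℂ[X]) (k : ℕ) :
    iteratedDeriv k (fun t : ℝ => P.eval (t : ℂ)) 0 = k.factorial * P.coeff k := by
  rw [iteratedDeriv_eval_ofReal]
  simp [← coeff_zero_eq_eval_zero, coeff_iterate_derivative, Nat.descFactorial_self]

/-- Substituting `t` for `X` is an algebra homomorphism on matrices, hence commutes with applying
`q`. -/
theorem trace_aeval_add_smul (φ : Matrix (Fin n) (Fin n) ℂ →ₐ[ℂ] (H →L[ℂ] H))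
    (hφ : ∀ A, LinearMap.trace ℂ H (φ A : H →ₗ[ℂ] H) = trace A)
    (M : Matrix (Fin n) (Fin n) ℂ) (lam : Fin n → ℝ) (q : ℝ[X]) (t : ℝ) :
    LinearMap.trace ℂ H
        (aeval (φ (diagonal fun i => (lam i : ℂ)) + (t : ℂ) • φ M) q : H →L[ℂ] H) =
      (trace (aeval (matrixPencil M lam) q)).eval (t : ℂ) := by
  let ψ : Matrix (Fin n) (Fin n) ℂ[X] →ₐ[ℝ] Matrix (Fin n) (Fin n) ℂ :=
    (((aeval (t : ℂ) : ℂ[X] →ₐ[ℂ] ℂ).restrictScalars ℝ).mapMatrix)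
  have hψ : ψ (matrixPencil M lam) = diagonal (fun i => (lam i : ℂ)) + (t : ℂ) • M := by
    ext i j
    by_cases hij : i = j <;> simp [ψ, matrixPencil, hij] <;> exact mul_comm _ _
  have h1 : aeval (φ (diagonal fun i => (lam i : ℂ)) + (t : ℂ) • φ M) q =
      (φ.restrictScalars ℝ) (ψ (aeval (matrixPencil M lam) q)) := by
    rw [← aeval_algHom_apply, ← aeval_algHom_apply, hψ]
    congr 2
    simp only [AlgHom.coe_restrictScalars', map_add, map_smul]
  rw [h1]
  refine (hφ _).trans ?_
  simp [trace, ψ, eval_finsetSum, coe_aeval_eq_eval]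

/-- The image of a diagonal matrix unit is killed by `λ - φ(D)`, and it is nonzero because its trace
is `1`. -/
theorem mem_spectrum_of_diagonal (φ : Matrix (Fin n) (Fin n) ℂ →ₐ[ℂ] (H →L[ℂ] H))
    (hφ : ∀ A, LinearMap.trace ℂ H (φ A : H →ₗ[ℂ] H) = trace A) (lam : Fin n → ℝ) (i : Fin n) :
    lam i ∈ spectrum ℝ (φ (diagonal fun i => (lam i : ℂ))) := by
  rw [spectrum.mem_iff]
  intro hu
  have h0 : (algebraMap ℝ (H →L[ℂ] H) (lam i) - φ (diagonal fun i => (lam i : ℂ))) *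
      φ (single i i 1) = 0 := by
    have : algebraMap ℝ (H →L[ℂ] H) (lam i) = φ (algebraMap ℂ _ (lam i : ℂ)) := by
      rw [AlgHom.commutes]
      rfl
    rw [this, ← map_sub, ← map_mul, ← map_zero φ]
    congr 1
    rw [algebraMap_eq_diagonal, diagonal_sub]
    ext a b
    rw [diagonal_mul]
    by_cases ha : i = a
    · subst ha
      simp
    · simp [ha]
  have h1 := hφ (single i i 1)
  rw [(hu.mul_right_eq_zero).1 h0] at h1
  simp at h1

/-- Cyclicity of the trace kills the off-diagonal units and equates the traces of the diagonal ones;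
these sum to `n`, so each is `1`. -/
theorem IsMatrixUnits.exists_algHom [FiniteDimensional ℂ H] [CompleteSpace H]
    (hn : Module.finrank ℂ H = n) {e : Fin n → Fin n → (H →L[ℂ] H)} (he : IsMatrixUnits e) :
    ∃ φ : Matrix (Fin n) (Fin n) ℂ →ₐ[ℂ] (H →L[ℂ] H),
      (∀ A, φ A = ∑ i, ∑ j, A i j • e i j) ∧
      ∀ A, LinearMap.trace ℂ H (φ A : H →ₗ[ℂ] H) = trace A := by
  let L : Matrix (Fin n) (Fin n) ℂ →ₗ[ℂ] (H →L[ℂ] H) :=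
    { toFun := fun A => ∑ i, ∑ j, A i j • e i j
      map_add' := fun A B => by simp [add_smul, Finset.sum_add_distrib]
      map_smul' := fun c A => by simp [mul_smul, Finset.smul_sum] }
  have hone : L 1 = 1 := by
    simp [L, Matrix.one_apply, ite_smul, he.sum_eq_one]
  have hmul : ∀ A B, L (A * B) = L A * L B := by
    intro A B
    simp only [L, LinearMap.coe_mk, AddHom.coe_mk, Matrix.mul_apply, Finset.sum_smul]
    simp_rw [Finset.sum_mul, Finset.mul_sum, smul_mul_smul_comm, he.mul_eq, smul_ite, smul_zero]
    refine Finset.sum_congr rfl fun i _ => ?_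
    rw [Finset.sum_comm]
    refine Finset.sum_congr rfl fun k _ => ?_
    rw [Finset.sum_comm]
    simp
  have tr_mul : ∀ S T : H →L[ℂ] H, LinearMap.trace ℂ H ((S * T : H →L[ℂ] H) : H →ₗ[ℂ] H) =
      LinearMap.trace ℂ H ((T * S : H →L[ℂ] H) : H →ₗ[ℂ] H) := fun S T =>
    LinearMap.trace_mul_comm ℂ (S : H →ₗ[ℂ] H) (T : H →ₗ[ℂ] H)
  have hoff : ∀ i j, i ≠ j → LinearMap.trace ℂ H (e i j : H →ₗ[ℂ] H) = 0 := by
    intro i j hij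
    have h1 : e i j = e i j * e j j := by rw [he.mul_eq, if_pos rfl]
    rw [h1, tr_mul, he.mul_eq, if_neg hij.symm]
    simp
  have heq : ∀ i j, LinearMap.trace ℂ H (e i i : H →ₗ[ℂ] H) =
      LinearMap.trace ℂ H (e j j : H →ₗ[ℂ] H) := by
    intro i j
    have h1 : e i i = e i j * e j i := by rw [he.mul_eq, if_pos rfl]
    rw [h1, tr_mul, he.mul_eq, if_pos rfl]
  have hdiag : ∀ i, LinearMap.trace ℂ H (e i i : H →ₗ[ℂ] H) = 1 := by
    intro i
    have h1 : LinearMap.trace ℂ H ((∑ j, e j j : H →L[ℂ] H) : H →ₗ[ℂ] H) = n := by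
      rw [he.sum_eq_one, ← hn]
      exact LinearMap.trace_one ℂ H
    rw [ContinuousLinearMap.toLinearMap_sum, map_sum,
      Finset.sum_congr rfl (fun j _ => heq j i)] at h1
    have hn0 : (n : ℂ) ≠ 0 := by
      have := i.pos
      exact_mod_cast this.ne'
    simpa [hn0] using h1
  refine ⟨AlgHom.ofLinearMap L hone hmul, fun A => rfl, fun A => ?_⟩
  change LinearMap.trace ℂ H ((∑ i, ∑ j, A i j • e i j : H →L[ℂ] H) : H →ₗ[ℂ] H) = _
  simp only [ContinuousLinearMap.toLinearMap_sum, ContinuousLinearMap.toLinearMap_smul, map_sum,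
    map_smul, trace, diag_apply]
  refine Finset.sum_congr rfl fun i _ => ?_
  rw [Finset.sum_eq_single i (fun j _ hj => by rw [hoff i j hj.symm, smul_zero]) (by simp),
    hdiag, smul_eq_mul, mul_one]

/-- Needed at `x + t h` with `t ≠ 0`, which the given matrix units need not diagonalise.
Orthonormality of the eigenbasis gives the bound on the entries. -/
theorem IsSelfAdjoint.exists_algHom_diagonal [FiniteDimensional ℂ H] [CompleteSpace H]
    (hn : Module.finrank ℂ H = n) {y : H →L[ℂ] H} (hy : IsSelfAdjoint y) (h : H →L[ℂ] H) :
    ∃ (φ : Matrix (Fin n) (Fin n) ℂ →ₐ[ℂ] (H →L[ℂ] H)) (lam : Fin n → ℝ)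
      (M : Matrix (Fin n) (Fin n) ℂ),
      (∀ A, LinearMap.trace ℂ H (φ A : H →ₗ[ℂ] H) = trace A) ∧
      y = φ (diagonal fun i => (lam i : ℂ)) ∧ h = φ M ∧ ∀ i j, ‖M i j‖ ≤ ‖h‖ := by
  have hs : (y : H →ₗ[ℂ] H).IsSymmetric :=
    (ContinuousLinearMap.isSelfAdjoint_iff_isSymmetric).1 hy
  let b := hs.eigenvectorBasis hn
  let L : Matrix (Fin n) (Fin n) ℂ →ₗ[ℂ] (H →L[ℂ] H) :=
    (LinearMap.toContinuousLinearMap : (H →ₗ[ℂ] H) ≃ₗ[ℂ] _).toLinearMap ∘ₗ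
      (toLinAlgEquiv b.toBasis).toLinearMap
  have hL : ∀ A, (L A : H →ₗ[ℂ] H) = toLinAlgEquiv b.toBasis A := fun A => rfl
  let φ : Matrix (Fin n) (Fin n) ℂ →ₐ[ℂ] (H →L[ℂ] H) := AlgHom.ofLinearMap L
    (by
      apply ContinuousLinearMap.coe_injective
      rw [hL, map_one]
      rfl)
    (fun A B => by
      apply ContinuousLinearMap.coe_injective
      rw [hL, map_mul]
      rfl)
  have hφ : ∀ A, (φ A : H →ₗ[ℂ] H) = toLinAlgEquiv b.toBasis A := fun A => rfl
  refine ⟨φ, hs.eigenvalues hn, LinearMap.toMatrixAlgEquiv b.toBasis (h : H →ₗ[ℂ] H),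
    fun A => ?_, ?_, ?_, fun i j => ?_⟩
  · rw [hφ, LinearMap.trace_eq_matrix_trace ℂ b.toBasis]
    congr 1
    exact LinearMap.toMatrix_toLin b.toBasis b.toBasis A
  · apply ContinuousLinearMap.coe_injective
    rw [hφ]
    refine b.toBasis.ext fun i => ?_
    rw [toLinAlgEquiv_self]
    simp only [diagonal_apply, ite_smul, zero_smul, Finset.sum_ite_eq',
      Finset.mem_univ, if_true, OrthonormalBasis.coe_toBasis]
    exact hs.apply_eigenvectorBasis hn i
  · apply ContinuousLinearMap.coe_injective
    rw [hφ, toLinAlgEquiv_toMatrixAlgEquiv]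
  · rw [LinearMap.toMatrixAlgEquiv_apply, OrthonormalBasis.coe_toBasis_repr_apply,
      OrthonormalBasis.coe_toBasis, OrthonormalBasis.repr_apply_apply]
    refine (norm_inner_le_norm _ _).trans ?_
    rw [b.norm_eq_one, one_mul]
    refine (h.le_opNorm _).trans ?_
    rw [b.norm_eq_one, mul_one]

end Operators

open Filter Topology

/-! ### Approximation by polynomials together with derivatives -/

section Approximation

open Polynomial

theorem exists_derivative_eq (r : ℝ[X]) : ∃ q : ℝ[X], derivative q = r := by
  induction r using Polynomial.induction_on' with
  | add p q hp hq =>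
    obtain ⟨P, rfl⟩ := hp
    obtain ⟨Q, rfl⟩ := hq
    exact ⟨P + Q, derivative_add⟩
  | monomial n a =>
    refine ⟨monomial (n + 1) (a / (n + 1)), ?_⟩
    rw [derivative_monomial]
    congr 1
    push_cast
    field_simp

/-- Approximate the derivative by induction, integrate, and fix the constant so that the values at
`c` agree. -/
theorem exists_polynomial_near_iteratedDeriv {a b c d : ℝ} (hac : a < c) (hcd : c ≤ d)
    (hdb : d < b) (N : ℕ) {f : ℝ → ℝ} (hf : ContDiffOn ℝ ∞ f (Set.Ioo a b)) {δ : ℝ}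
    (hδ : 0 < δ) :
    ∃ q : ℝ[X], ∀ k ≤ N, ∀ y ∈ Set.Icc c d,
      |(derivative^[k] q).eval y - iteratedDeriv k f y| ≤ δ := by
  have hsub : Set.Icc c d ⊆ Set.Ioo a b := Set.Icc_subset_Ioo hac hdb
  induction N generalizing f δ with
  | zero =>
    obtain ⟨q, hq⟩ := exists_polynomial_near_of_continuousOn c d f (hf.continuousOn.mono hsub) δ hδ
    refine ⟨q, fun k hk y hy => ?_⟩
    obtain rfl : k = 0 := by omega
    simpa using (hq y hy).le
  | succ N ih =>
    have hf' := (contDiffOn_infty_iff_deriv_of_isOpen isOpen_Ioo).1 hf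
    have hdc : 0 ≤ d - c := sub_nonneg.2 hcd
    -- Integration multiplies the error by at most `d - c`; the `+ 1` keeps the quotient meaningful
    -- when `c = d`.
    obtain ⟨r, hr⟩ := ih hf'.2 (δ := min δ (δ / (d - c + 1))) (lt_min hδ (by positivity))
    obtain ⟨q, rfl⟩ := exists_derivative_eq r
    refine ⟨q + C (f c - q.eval c), fun k hk y hy => ?_⟩
    cases k with
    | zero =>
      have hm := (convex_Icc c d).norm_image_sub_le_of_norm_hasDerivWithin_le
        (f := fun z => (q + C (f c - q.eval c)).eval z - f z) (C := δ / (d - c + 1))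
        (fun z hz => (((q + C (f c - q.eval c)).hasDerivAt z).sub
          ((hf'.1.differentiableAt (isOpen_Ioo.mem_nhds (hsub hz))).hasDerivAt)).hasDerivWithinAt)
        (fun z hz => by simpa using (hr 0 (Nat.zero_le _) z hz).trans (min_le_right _ _))
        (Set.left_mem_Icc.2 hcd) hy
      have h0 : (q + C (f c - q.eval c)).eval c - f c = 0 := by simp
      rw [h0, sub_zero] at hm
      simp only [Function.iterate_zero, id_eq, iteratedDeriv_zero]
      refine hm.trans ?_
      rw [Real.norm_eq_abs, abs_of_nonneg (sub_nonneg.2 hy.1), div_mul_eq_mul_div,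
        div_le_iff₀ (by positivity)]
      exact mul_le_mul_of_nonneg_left (by linarith [hy.2]) hδ.le
    | succ k =>
      rw [Function.iterate_succ_apply, derivative_add, derivative_C, add_zero, iteratedDeriv_succ']
      exact (hr k (by omega) y hy).trans (min_le_left _ _)

theorem exists_polynomial_seq_near_iteratedDeriv {a b c d : ℝ} (hac : a < c) (hcd : c ≤ d)
    (hdb : d < b) {f : ℝ → ℝ} (hf : ContDiffOn ℝ ∞ f (Set.Ioo a b)) :
    ∃ q : ℕ → ℝ[X], ∀ m, ∀ k ≤ m, ∀ y ∈ Set.Icc c d,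
      |(derivative^[k] (q m)).eval y - iteratedDeriv k f y| ≤ 1 / ((m : ℝ) + 1) := by
  choose q hq using fun m : ℕ => exists_polynomial_near_iteratedDeriv hac hcd hdb m hf
    (δ := 1 / ((m : ℝ) + 1)) (by positivity)
  exact ⟨q, hq⟩

end Approximation

/-! ### Passage to the limit -/

theorem tendsto_dividedDiffSorted {ι : Type*} {l : Filter ι} {F : ι → ℝ → ℝ} {f : ℝ → ℝ} (n : ℕ)
    (x : Fin (n + 1) → ℝ)
    (h : ∀ k i, Tendsto (fun m => iteratedDeriv k (F m) (x i)) l (𝓝 (iteratedDeriv k f (x i)))) :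
    Tendsto (fun m => dividedDiffSorted (F m) n x) l (𝓝 (dividedDiffSorted f n x)) := by
  induction n with
  | zero => simpa [dividedDiffSorted] using h 0 0
  | succ n ih =>
    simp only [dividedDiffSorted]
    split_ifs
    · exact (h _ _).div_const _
    · exact ((ih (Fin.init x) fun k i => h k i.castSucc).sub
        (ih (Fin.tail x) fun k i => h k i.succ)).div_const _

theorem tendsto_dividedDiff {ι : Type*} {l : Filter ι} {F : ι → ℝ → ℝ} {f : ℝ → ℝ} {n : ℕ}
    (x : Fin (n + 1) → ℝ)
    (h : ∀ k i, Tendsto (fun m => iteratedDeriv k (F m) (x i)) l (𝓝 (iteratedDeriv k f (x i)))) :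
    Tendsto (fun m => dividedDiff (F m) x) l (𝓝 (dividedDiff f x)) :=
  tendsto_dividedDiffSorted n _ fun k i => h k (Tuple.sort x i)

theorem contDiffOn_of_hasDerivAt_seq {E : Type*} [NormedAddCommGroup E] [NormedSpace ℝ E]
    {U : Set ℝ} (hU : IsOpen U) {g : ℕ → ℝ → E}
    (hg : ∀ k, ∀ t ∈ U, HasDerivAt (g k) (g (k + 1) t) t) : ContDiffOn ℝ ∞ (g 0) U := by
  refine contDiffOn_infty.2 fun N => ?_
  generalize 0 = k
  induction N generalizing k with
  | zero =>
    exact contDiffOn_zero.2 fun t ht => (hg k t ht).continuousAt.continuousWithinAt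
  | succ N ih =>
    push_cast
    refine (contDiffOn_succ_iff_deriv_of_isOpen hU).2
      ⟨fun t ht => (hg k t ht).differentiableAt.differentiableWithinAt, by simp, ?_⟩
    exact (ih (k + 1)).congr fun t ht => (hg k t ht).deriv

theorem iteratedDeriv_eqOn_of_hasDerivAt_seq {E : Type*} [NormedAddCommGroup E] [NormedSpace ℝ E]
    {U : Set ℝ} (hU : IsOpen U) {g : ℕ → ℝ → E}
    (hg : ∀ k, ∀ t ∈ U, HasDerivAt (g k) (g (k + 1) t) t) (k : ℕ) :
    Set.EqOn (iteratedDeriv k (g 0)) (g k) U := by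
  induction k with
  | zero => exact fun t _ => by simp
  | succ k ih =>
    intro t ht
    rw [iteratedDeriv_succ, (ih.eventuallyEq_of_mem (hU.mem_nhds ht)).deriv_eq]
    exact (hg k t ht).deriv

/-- Differentiation under uniform limits, one order at a time. Order `0` needs only pointwise
convergence. -/
theorem exists_contDiffOn_limit {E : Type*} [NormedAddCommGroup E] [NormedSpace ℝ E]
    [CompleteSpace E] {U : Set ℝ} (hU : IsOpen U) {G : ℝ → E} {Gm : ℕ → ℝ → E}
    (hGm : ∀ m, ContDiff ℝ ∞ (Gm m))
    (h0 : ∀ t ∈ U, Tendsto (fun m => Gm m t) atTop (𝓝 (G t)))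
    (hC : ∀ k, 0 < k → UniformCauchySeqOn (fun m => iteratedDeriv k (Gm m)) atTop U) :
    ContDiffOn ℝ ∞ G U ∧ ∀ k, ∀ t ∈ U,
      Tendsto (fun m => iteratedDeriv k (Gm m) t) atTop (𝓝 (iteratedDeriv k G t)) := by
  -- At order `0` the limit is prescribed as `G t` even off `U`, so that the chosen `g 0` is `G`
  -- itself; at higher orders the value off `U` is a dummy.
  have hex : ∀ k t, ∃ L, (k = 0 → L = G t) ∧
      (t ∈ U → Tendsto (fun m => iteratedDeriv k (Gm m) t) atTop (𝓝 L)) := by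
    intro k t
    rcases Nat.eq_zero_or_pos k with rfl | hk
    · exact ⟨G t, fun _ => rfl, fun ht => by simpa using h0 t ht⟩
    · by_cases ht : t ∈ U
      · obtain ⟨L, hL⟩ := cauchySeq_tendsto_of_complete ((hC k hk).cauchySeq ht)
        exact ⟨L, fun h => absurd h hk.ne', fun _ => hL⟩
      · exact ⟨0, fun h => absurd h hk.ne', fun h => absurd h ht⟩
  choose g hg0 hg using hex
  obtain rfl : g 0 = G := funext fun t => hg0 0 t rfl
  have hder : ∀ k, ∀ t ∈ U, HasDerivAt (g k) (g (k + 1) t) t := fun k t ht =>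
    hasDerivAt_of_tendstoUniformlyOn hU
      ((hC (k + 1) k.succ_pos).tendstoUniformlyOn_of_tendsto fun s hs => hg (k + 1) s hs)
      (Eventually.of_forall fun m s _ => by
        rw [iteratedDeriv_succ]
        exact ((hGm m).differentiable_iteratedDeriv k (by exact_mod_cast ENat.natCast_lt_top k)
          s).hasDerivAt)
      (fun s hs => hg k s hs) ht
  refine ⟨contDiffOn_of_hasDerivAt_seq hU hder, fun k t ht => ?_⟩
  rw [iteratedDeriv_eqOn_of_hasDerivAt_seq hU hder k ht]
  exact hg k t ht

/-! ### The trace function: perturbation, bounds and limits -/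

section TraceFun

open Polynomial Matrix

variable {H : Type*} [NormedAddCommGroup H] [InnerProductSpace ℂ H] [CompleteSpace H] {n : ℕ}

theorem isSelfAdjoint_add_ofReal_smul {x h : H →L[ℂ] H} (hx : IsSelfAdjoint x)
    (hh : IsSelfAdjoint h) (t : ℝ) : IsSelfAdjoint (x + (t : ℂ) • h) :=
  hx.add (IsSelfAdjoint.smul (Complex.conj_ofReal t) hh)

theorem traceFun_polynomial {x h : H →L[ℂ] H} (hx : IsSelfAdjoint x) (hh : IsSelfAdjoint h)
    (q : ℝ[X]) (t : ℝ) :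
    traceFun (fun s => q.eval s) x h t =
      LinearMap.trace ℂ H (aeval (x + (t : ℂ) • h) q : H →L[ℂ] H) := by
  rw [traceFun, cfc_polynomial q _ (isSelfAdjoint_add_ofReal_smul hx hh t)]

theorem traceFun_polynomial_eq_eval (φ : Matrix (Fin n) (Fin n) ℂ →ₐ[ℂ] (H →L[ℂ] H))
    (hφ : ∀ A, LinearMap.trace ℂ H (φ A : H →ₗ[ℂ] H) = trace A)
    {M : Matrix (Fin n) (Fin n) ℂ} {lam : Fin n → ℝ} {x h : H →L[ℂ] H} (hx : IsSelfAdjoint x)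
    (hh : IsSelfAdjoint h) (hxφ : x = φ (diagonal fun i => (lam i : ℂ))) (hhφ : h = φ M)
    (q : ℝ[X]) :
    traceFun (fun s => q.eval s) x h =
      fun t : ℝ => (trace (aeval (matrixPencil M lam) q)).eval (t : ℂ) := by
  ext t
  rw [traceFun_polynomial hx hh, hxφ, hhφ, trace_aeval_add_smul φ hφ]

theorem iteratedDeriv_traceFun_polynomial (φ : Matrix (Fin n) (Fin n) ℂ →ₐ[ℂ] (H →L[ℂ] H))
    (hφ : ∀ A, LinearMap.trace ℂ H (φ A : H →ₗ[ℂ] H) = trace A)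
    {M : Matrix (Fin n) (Fin n) ℂ} {lam : Fin n → ℝ} {x h : H →L[ℂ] H} (hx : IsSelfAdjoint x)
    (hh : IsSelfAdjoint h) (hxφ : x = φ (diagonal fun i => (lam i : ℂ))) (hhφ : h = φ M)
    (q : ℝ[X]) (p : ℕ) (hp : 0 < p) :
    iteratedDeriv p (traceFun (fun s => q.eval s) x h) 0 =
      p.factorial * ∑ i : Fin p → Fin n, (∏ k, M (i k) (i (finRotate p k))) *
        (polyDD q (Fin.snoc (α := fun _ => ℝ) (fun k : Fin p => lam (i k)) (lam (i ⟨0, hp⟩))) :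
          ℝ) := by
  rw [traceFun_polynomial_eq_eval φ hφ hx hh hxφ hhφ, iteratedDeriv_eval_ofReal_zero,
    coeff_trace_aeval_matrixPencil]

theorem traceFun_add (f : ℝ → ℝ) (x h : H →L[ℂ] H) (s t : ℝ) :
    traceFun f x h (s + t) = traceFun f (x + (s : ℂ) • h) h t := by
  simp [traceFun, add_smul, add_assoc]

/-- In the operator order, `c ≤ x ≤ d` and `-‖t h‖ ≤ t h ≤ ‖t h‖` add up. -/
theorem spectrum_add_smul_subset {x h : H →L[ℂ] H} (hx : IsSelfAdjoint x)
    (hh : IsSelfAdjoint h) {c d δ t : ℝ} (hspec : spectrum ℝ x ⊆ Set.Icc c d)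
    (ht : |t| * ‖h‖ ≤ δ) :
    spectrum ℝ (x + (t : ℂ) • h) ⊆ Set.Icc (c - δ) (d + δ) := by
  have hth : IsSelfAdjoint ((t : ℂ) • h) := IsSelfAdjoint.smul (Complex.conj_ofReal t) hh
  have hnorm : ‖(t : ℂ) • h‖ ≤ δ := by simpa [norm_smul] using ht
  have hmono : algebraMap ℝ (H →L[ℂ] H) ‖(t : ℂ) • h‖ ≤ algebraMap ℝ (H →L[ℂ] H) δ :=
    algebraMap_mono _ hnorm
  have h1 : algebraMap ℝ (H →L[ℂ] H) c ≤ x :=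
    (algebraMap_le_iff_le_spectrum (a := x)).2 fun z hz => (hspec hz).1
  have h2 : x ≤ algebraMap ℝ (H →L[ℂ] H) d :=
    (le_algebraMap_iff_spectrum_le (a := x)).2 fun z hz => (hspec hz).2
  have hy := isSelfAdjoint_add_ofReal_smul hx hh t
  refine fun z hz => ⟨?_, ?_⟩
  · refine (algebraMap_le_iff_le_spectrum (a := x + (t : ℂ) • h)).1 ?_ z hz
    rw [map_sub, sub_eq_add_neg]
    exact add_le_add h1 ((neg_le_neg hmono).trans hth.neg_algebraMap_norm_le_self)
  · refine (le_algebraMap_iff_spectrum_le (a := x + (t : ℂ) • h)).1 ?_ z hz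
    rw [map_add]
    exact add_le_add h2 (hth.le_algebraMap_norm_self.trans hmono)

theorem exists_Icc_spectrum_subset {x : H →L[ℂ] H} {a b : ℝ} [Nontrivial H]
    (hx : IsSelfAdjoint x) (hspec : spectrum ℝ x ⊆ Set.Ioo a b) :
    ∃ c d, a < c ∧ c ≤ d ∧ d < b ∧ spectrum ℝ x ⊆ Set.Icc c d := by
  have hne : (spectrum ℝ x).Nonempty := ContinuousFunctionalCalculus.spectrum_nonempty x hx
  have hcomp : IsCompact (spectrum ℝ x) := ContinuousFunctionalCalculus.isCompact_spectrum x
  obtain ⟨c, hc, hc'⟩ := hcomp.exists_isLeast hne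
  obtain ⟨d, hd, hd'⟩ := hcomp.exists_isGreatest hne
  exact ⟨c, d, (hspec hc).1, hc' hd, (hspec hd).2, fun z hz => ⟨hc' hz, hd' hz⟩⟩

theorem traceFun_polynomial_sub {x h : H →L[ℂ] H} (hx : IsSelfAdjoint x) (hh : IsSelfAdjoint h)
    (q r : ℝ[X]) :
    traceFun (fun s => (q - r).eval s) x h =
      traceFun (fun s => q.eval s) x h - traceFun (fun s => r.eval s) x h := by
  ext t
  simp only [traceFun_polynomial hx hh, Pi.sub_apply, map_sub, ContinuousLinearMap.toLinearMap_sub]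

variable [FiniteDimensional ℂ H]

theorem contDiff_traceFun_polynomial {x h : H →L[ℂ] H} (hx : IsSelfAdjoint x)
    (hh : IsSelfAdjoint h) (q : ℝ[X]) :
    ContDiff ℝ ∞ (traceFun (fun s => q.eval s) x h) := by
  obtain ⟨φ, lam, M, hφ, hxφ, hhφ, -⟩ := hx.exists_algHom_diagonal rfl h
  rw [traceFun_polynomial_eq_eval φ hφ hx hh hxφ hhφ]
  exact ((Polynomial.differentiable _).contDiff.restrict_scalars ℝ).comp Complex.ofRealCLM.contDiff

/-- There are `n ^ p` closed paths, each contributing at most `‖h‖ ^ p * B`. Since `t` enters only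
through the interval containing the spectrum, the bound is uniform in `t`. -/
theorem norm_iteratedDeriv_traceFun_polynomial_le (hn : Module.finrank ℂ H = n)
    {x h : H →L[ℂ] H} (hx : IsSelfAdjoint x) (hh : IsSelfAdjoint h) {c d : ℝ} {t : ℝ}
    (hspec : spectrum ℝ (x + (t : ℂ) • h) ⊆ Set.Icc c d) (q : ℝ[X]) {p : ℕ} (hp : 0 < p) {B : ℝ}
    (hB : ∀ y ∈ Set.Icc c d, |(derivative^[p] q).eval y| ≤ B) :
    ‖iteratedDeriv p (traceFun (fun s => q.eval s) x h) t‖ ≤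
      p.factorial * (n ^ p * ‖h‖ ^ p) * B := by
  have hy := isSelfAdjoint_add_ofReal_smul hx hh t
  obtain ⟨φ, lam, M, hφ, hyφ, hhφ, hM⟩ := hy.exists_algHom_diagonal hn h
  have hlam : ∀ i, lam i ∈ Set.Icc c d := fun i =>
    hspec (hyφ ▸ mem_spectrum_of_diagonal φ hφ lam i)
  -- Move the base point to `x + t h`, so that the formula at `0` applies.
  have hshift : iteratedDeriv p (traceFun (fun s => q.eval s) x h) t =
      iteratedDeriv p (traceFun (fun s => q.eval s) (x + (t : ℂ) • h) h) 0 := by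
    have := congrFun (iteratedDeriv_comp_const_add p (traceFun (fun s => q.eval s) x h) t) 0
    rw [add_zero] at this
    rw [← this]
    congr 1
    ext s
    exact traceFun_add _ x h t s
  rw [hshift, iteratedDeriv_traceFun_polynomial φ hφ hy hh hyφ hhφ q p hp, norm_mul,
    Complex.norm_natCast, mul_assoc, mul_assoc]
  gcongr
  refine (norm_sum_le _ _).trans ?_
  have hterm : ∀ i : Fin p → Fin n, ‖(∏ k, M (i k) (i (finRotate p k))) *
      ((polyDD q (Fin.snoc (α := fun _ => ℝ) (fun k : Fin p => lam (i k)) (lam (i ⟨0, hp⟩))) : ℝ) :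
        ℂ)‖ ≤ ‖h‖ ^ p * B := by
    intro i
    rw [norm_mul, norm_prod, Complex.norm_real, Real.norm_eq_abs]
    gcongr
    · calc ∏ k, ‖M (i k) (i (finRotate p k))‖ ≤ ∏ _k : Fin p, ‖h‖ :=
            Finset.prod_le_prod (fun _ _ => norm_nonneg _) fun _ _ => hM _ _
        _ = ‖h‖ ^ p := by simp
    · refine abs_polyDD_le q p _ (fun k => ?_) hB
      refine Fin.lastCases ?_ (fun k => ?_) k
      · simpa using hlam _
      · simpa using hlam _
  refine (Finset.sum_le_sum fun i _ => hterm i).trans (le_of_eq ?_)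
  simp

theorem tendsto_traceFun_polynomial {x h : H →L[ℂ] H} {c d t : ℝ}
    (hspec : spectrum ℝ (x + (t : ℂ) • h) ⊆ Set.Icc c d) {f : ℝ → ℝ}
    (hf : ContinuousOn f (Set.Icc c d)) {q : ℕ → ℝ[X]} {δ : ℕ → ℝ}
    (hδ : Tendsto δ atTop (𝓝 0)) (hδ0 : ∀ m, 0 ≤ δ m)
    (hq : ∀ m, ∀ y ∈ Set.Icc c d, |(q m).eval y - f y| ≤ δ m) :
    Tendsto (fun m => traceFun (fun s => (q m).eval s) x h t) atTop (𝓝 (traceFun f x h t)) := by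
  let T : (H →L[ℂ] H) →ₗ[ℂ] ℂ := LinearMap.trace ℂ H ∘ₗ ContinuousLinearMap.coeLM ℂ
  have hT : Continuous T := T.continuous_of_finiteDimensional
  refine (hT.tendsto (cfc f (x + (t : ℂ) • h))).comp ?_
  rw [tendsto_iff_norm_sub_tendsto_zero]
  refine squeeze_zero (fun _ => norm_nonneg _) (fun m => ?_) hδ
  rw [← cfc_sub _ _ _ ((q m).continuous.continuousOn) (hf.mono hspec)]
  exact norm_cfc_le (hδ0 m) fun y hy => hq m y (hspec hy)

theorem traceFun_limit (hn : Module.finrank ℂ H = n) {x h : H →L[ℂ] H}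
    (hx : IsSelfAdjoint x) (hh : IsSelfAdjoint h) {a b c d : ℝ} (hac : a < c) (hcd : c ≤ d)
    (hdb : d < b) {f : ℝ → ℝ} (hf : ContDiffOn ℝ ∞ f (Set.Ioo a b)) {U : Set ℝ} (hU : IsOpen U)
    (hspec : ∀ t ∈ U, spectrum ℝ (x + (t : ℂ) • h) ⊆ Set.Icc c d) :
    ContDiffOn ℝ ∞ (traceFun f x h) U ∧ ∃ q : ℕ → ℝ[X],
      (∀ k, ∀ y ∈ Set.Icc c d, Tendsto (fun m => iteratedDeriv k (fun s => (q m).eval s) y) atTop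
        (𝓝 (iteratedDeriv k f y))) ∧
      ∀ k, ∀ t ∈ U, Tendsto (fun m => iteratedDeriv k (traceFun (fun s => (q m).eval s) x h) t)
        atTop (𝓝 (iteratedDeriv k (traceFun f x h) t)) := by
  obtain ⟨q, hq⟩ := exists_polynomial_seq_near_iteratedDeriv hac hcd hdb hf
  have hlim := tendsto_one_div_add_atTop_nhds_zero_nat (𝕜 := ℝ)
  have key := exists_contDiffOn_limit hU (G := traceFun f x h)
    (fun m => contDiff_traceFun_polynomial hx hh (q m))
    (fun t ht => tendsto_traceFun_polynomial (hspec t ht)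
      (hf.continuousOn.mono (Set.Icc_subset_Ioo hac hdb)) hlim (fun m => by positivity)
      fun m y hy => by simpa using hq m 0 (Nat.zero_le m) y hy) ?_
  · refine ⟨key.1, q, fun k y hy => ?_, key.2⟩
    rw [tendsto_iff_norm_sub_tendsto_zero]
    refine squeeze_zero' (Eventually.of_forall fun _ => norm_nonneg _) ?_ hlim
    filter_upwards [eventually_ge_atTop k] with m hm
    rw [iteratedDeriv_polynomial_eval]
    exact hq m k hm y hy
  · intro k hk
    rw [Metric.uniformCauchySeqOn_iff]
    intro ε hε
    set K : ℝ := k.factorial * (n ^ k * ‖h‖ ^ k)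
    -- The `k`-th derivatives of `q m` and `q l` are each within `1 / (N + 1)` of that of `f`, hence
    -- the factor `2`; `K` is the constant of the norm bound.
    have hlim2 : Tendsto (fun N : ℕ => K * (2 * (1 / ((N : ℝ) + 1)))) atTop (𝓝 0) := by
      simpa using (hlim.const_mul 2).const_mul K
    obtain ⟨N, hN, hkN⟩ := ((hlim2.eventually_lt_const hε).and (eventually_ge_atTop k)).exists
    refine ⟨N, fun m hm l hl t ht => ?_⟩
    have hle : ∀ j ≥ N, ∀ y ∈ Set.Icc c d,
        |(derivative^[k] (q j)).eval y - iteratedDeriv k f y| ≤ 1 / ((N : ℝ) + 1) :=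
      fun j hj y hy => (hq j k (hkN.trans hj) y hy).trans (by gcongr)
    rw [dist_eq_norm, ← iteratedDeriv_sub
      ((contDiff_traceFun_polynomial hx hh (q m)).contDiffAt.of_le (by exact_mod_cast le_top))
      ((contDiff_traceFun_polynomial hx hh (q l)).contDiffAt.of_le (by exact_mod_cast le_top)),
      ← traceFun_polynomial_sub hx hh]
    refine (norm_iteratedDeriv_traceFun_polynomial_le hn hx hh (hspec t ht) _ hk
      fun y hy => ?_).trans_lt hN
    rw [iterate_derivative_sub, eval_sub, two_mul]
    refine (abs_sub_le _ (iteratedDeriv k f y) _).trans (add_le_add (hle m hm y hy) ?_)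
    rw [abs_sub_comm]
    exact hle l hl y hy

end TraceFun

/-! ### The theorem -/

theorem mainTheorem4 {H : Type*} [NormedAddCommGroup H] [InnerProductSpace ℂ H]
    [CompleteSpace H] [FiniteDimensional ℂ H] (n : ℕ) (hn : Module.finrank ℂ H = n)
    (a b : ℝ) (f : ℝ → ℝ) (hf : ContDiffOn ℝ ∞ f (Set.Ioo a b))
    (x h : H →L[ℂ] H) (hx : IsSelfAdjoint x) (hh : IsSelfAdjoint h)
    (e : Fin n → Fin n → (H →L[ℂ] H)) (he : IsMatrixUnits e)
    (lam : Fin n → ℝ) (hc : Fin n → Fin n → ℂ)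
    (hxe : x = ∑ i, (lam i : ℂ) • e i i) (hhe : h = ∑ i, ∑ j, hc i j • e i j)
    (hspec : spectrum ℝ x ⊆ Set.Ioo a b) :
    (∃ ε : ℝ, 0 < ε ∧ (∀ t ∈ Set.Ioo (-ε) ε, spectrum ℝ (x + (t : ℂ) • h) ⊆ Set.Ioo a b) ∧
      ContDiffOn ℝ ∞ (traceFun f x h) (Set.Ioo (-ε) ε)) ∧
    ∀ (p : ℕ) (hp : 0 < p),
      iteratedDeriv p (traceFun f x h) 0 =
        (p.factorial : ℂ) * ∑ i : Fin p → Fin n,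
          (∏ k : Fin p, hc (i k) (i (finRotate p k))) *
            (dividedDiff f
              (Fin.snoc (α := fun _ => ℝ) (fun k : Fin p => lam (i k)) (lam (i ⟨0, hp⟩))) : ℂ) := by
  obtain ⟨φ, hφe, hφ⟩ := he.exists_algHom hn
  have hxφ : x = φ (Matrix.diagonal fun i => (lam i : ℂ)) := by
    rw [hφe, hxe]
    simp [Matrix.diagonal_apply, ite_smul]
  have hhφ : h = φ (Matrix.of hc) := by
    rw [hφe, hhe]
    simp
  rcases subsingleton_or_nontrivial H with hH | hH
  -- On the zero space the spectrum is empty and yields no `c`, `d`; the sum is empty because `p >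
  -- 0`.
  · have h0 : traceFun f x h = fun _ => 0 := by
      ext t
      rw [traceFun, Subsingleton.elim (cfc f (x + (t : ℂ) • h)) 0]
      simp
    obtain rfl : n = 0 := by rw [← hn, Module.finrank_zero_of_subsingleton]
    refine ⟨⟨1, one_pos, fun t _ => ?_, ?_⟩, fun p hp => ?_⟩
    · rw [spectrum.of_subsingleton]
      exact Set.empty_subset _
    · rw [h0]
      exact contDiffOn_const
    · have : IsEmpty (Fin p → Fin 0) := ⟨fun i => (i ⟨0, hp⟩).elim0⟩
      rw [h0]
      simp
  · obtain ⟨c, d, hac, hcd, hdb, hsub⟩ := exists_Icc_spectrum_subset hx hspec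
    -- Room `δ` on both sides of the spectrum: perturbed spectra stay in a compact subinterval of
    -- the open one.
    obtain ⟨δ, hδ, hδm⟩ := exists_between (lt_min (sub_pos.2 hac) (sub_pos.2 hdb))
    have hδa : a < c - δ := by linarith [hδm.trans_le (min_le_left _ _)]
    have hδb : d + δ < b := by linarith [hδm.trans_le (min_le_right _ _)]
    have hε : 0 < δ / (‖h‖ + 1) := by positivity
    have hball : ∀ t ∈ Set.Ioo (-(δ / (‖h‖ + 1))) (δ / (‖h‖ + 1)),
        spectrum ℝ (x + (t : ℂ) • h) ⊆ Set.Icc (c - δ) (d + δ) := by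
      intro t ht
      refine spectrum_add_smul_subset hx hh hsub ?_
      have h1 := (lt_div_iff₀ (by positivity)).1 (abs_lt.2 ht)
      nlinarith [abs_nonneg t]
    obtain ⟨hsmooth, q, hq, hG⟩ := traceFun_limit hn hx hh hδa (by linarith) hδb hf isOpen_Ioo hball
    refine ⟨⟨_, hε, fun t ht => (hball t ht).trans (Set.Icc_subset_Ioo hδa hδb), hsmooth⟩,
      fun p hp => tendsto_nhds_unique (hG p 0 ⟨neg_lt_zero.2 hε, hε⟩) ?_⟩
    have hlam : ∀ i, lam i ∈ Set.Icc (c - δ) (d + δ) := fun i =>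
      Set.Icc_subset_Icc (by linarith) (by linarith)
        (hsub (hxφ ▸ mem_spectrum_of_diagonal φ hφ lam i))
    -- The derivative at `0` is computed with the given matrix units, so the limit carries the
    -- prescribed `lam` and `hc`.
    simp_rw [iteratedDeriv_traceFun_polynomial φ hφ hx hh hxφ hhφ _ p hp, ← dividedDiff_polynomial]
    refine Tendsto.const_mul _ (tendsto_finsetSum _ fun i _ => Tendsto.const_mul _ ?_)
    refine (Complex.continuous_ofReal.tendsto _).comp (tendsto_dividedDiff _ fun k j => hq k _ ?_)
    refine Fin.lastCases ?_ (fun j => ?_) j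
    · simpa using hlam _
    · simpa using hlam _
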